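/- Let $X$ be a complex Hilbert space, $U$ a complex Banach space, and $\alpha>0$. Let $A:D(A)\subset X\to X$ be diagonalizable, i.e. the resolvent set $\varrho(A)$ is non-empty and $X$ has a Riesz basis $(\varphi_n)_{n\in\mathbb N}$ consisting of eigenvectors of $A$. Suppose that $A$ generates a $C_0$-semigroup $(T(t))_{t\ge 0}$ that is polynomially stable with parameter $\alpha$, i.e. $\sup_{t\ge0}\|T(t)\|<\infty$, $\|T(t)(I-A)^{-1}\|\to0$ and $\|T(t)A^{-1}\|=O(t^{-1/\alpha})$ as $t\to\infty$. Let $B:U\to X$ be a bounded linear operator of finite rank with $\operatorname{ran}(B)\subset D((-A)^{\alpha})$, where $(-A)^\alpha$ is the fractional power of the sectorial operator $-A$. Then the linear system $$\dot x(t)=Ax(t)+Bu(t),\quad t\ge0,\qquad x(0)=x_0,$$ with inputs $u\in L^\infty(\mathbb R_+,U)$ is polynomially input-to-state stable with parameter $\alpha$. That is: (i) for all $x_0\in X$ and $u\in L^\infty(\mathbb R_+,U)$ there is a unique mild solution $\phi(\cdot,x_0,u)\in C(\mathbb R_+,X)$, i.e. a unique continuous function with $\phi(t,x_0,u)=T(t)x_0+\int_0^tT(t-s)Bu(s)\,\mathrm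 ds$ for all $t\ge 0$; (ii) there are $\gamma,\mu\in\mathcal K_\infty$ such that $\|\phi(t,x_0,u)\|\le\gamma(\|x_0\|)+\mu(\|u\|_\infty)$ for all $x_0\in X$, $u\in L^\infty(\mathbb R_+,U)$, $t\ge0$; (iii) there are $\kappa\in\mathcal{KL}$ and $\mu\in\mathcal K_\infty$ such that $\|\phi(t,x_0,u)\|\le\kappa(\|x_0\|+\|Ax_0\|,t)+\mu(\|u\|_\infty)$ for all $x_0\in D(A)$, $u\in L^\infty(\mathbb R_+,U)$, $t\ge0$, and, for every $r>0$, $\kappa(r,t)=O(t^{-1/\alpha})$ as $t\to\infty$. Here $\mathcal K$ is the set of continuous strictly increasing $\mu:\mathbb R_+\to\mathbb R_+$ with $\mu(0)=0$, $\mathcal K_\infty$ is the set of unbounded functions in $\mathcal K$, and $\mathcal{KL}$ is the set of continuous $\kappa:\mathbb R_+\times\mathbb R_+\to\mathbb R_+$ such that $\kappa(\cdot,t)\in\mathcal K$ for every $t\ge0$ and, for every $r>0$, $\kappa(r,\cdot)$ is strictly decreasing with limit $0$ at infinity. -/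

import Mathlib

open Set Filter Topology MeasureTheory Asymptotics
open scoped NNReal ENNReal

namespace PolyISS

noncomputable section

section Comparison

/-- Class `𝒦`: continuous, strictly increasing functions on `[0,∞)` vanishing at `0`. -/
structure IsClassK (μ : ℝ≥0 → ℝ≥0) : Prop where
  continuous : Continuous μ
  strictMono : StrictMono μ
  map_zero : μ 0 = 0

/-- Class `𝒦_∞`: unbounded functions of class `𝒦`. -/
structure IsClassKInf (μ : ℝ≥0 → ℝ≥0) : Prop extends IsClassK μ where
  unbounded : ¬ BddAbove (range μ)

/-- Class `ℒ`: continuous, strictly decreasing functions on `[0,∞)` tending to `0`. -/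
structure IsClassL (μ : ℝ≥0 → ℝ≥0) : Prop where
  continuous : Continuous μ
  strictAnti : StrictAnti μ
  tendsto_zero : Tendsto μ atTop (𝓝 0)

/-- Class `𝒦ℒ`. -/
structure IsClassKL (κ : ℝ≥0 → ℝ≥0 → ℝ≥0) : Prop where
  continuous : Continuous fun p : ℝ≥0 × ℝ≥0 => κ p.1 p.2
  classK : ∀ t, IsClassK fun r => κ r t
  classL : ∀ r, 0 < r → IsClassL fun t => κ r t

end Comparison

section Operators

variable {X : Type*} [NormedAddCommGroup X] [NormedSpace ℂ X]

/-- `R` is a bounded everywhere defined two-sided inverse of `μ I - A`: for every `x`, `R x` lies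
in `D(A)` with `A (R x) = μ R x - x`, and `R (μ x - A x) = x` for `x ∈ D(A)`. -/
def IsResolventAt (A : X →ₗ.[ℂ] X) (μ : ℂ) (R : X →L[ℂ] X) : Prop :=
  (∀ x : X, (R x, μ • R x - x) ∈ A.graph) ∧
    ∀ x : A.domain, R (μ • (x : X) - A x) = x

/-- The resolvent set `ϱ(A)`. -/
def resolventSet (A : X →ₗ.[ℂ] X) : Set ℂ :=
  {μ | ∃ R : X →L[ℂ] X, IsResolventAt A μ R}

open Classical in
/-- The resolvent `R(μ, A) = (μ I - A)⁻¹` for `μ ∈ ϱ(A)` (and `0` otherwise). -/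
def resolventOp (A : X →ₗ.[ℂ] X) (μ : ℂ) : X →L[ℂ] X :=
  if h : μ ∈ resolventSet A then Classical.choose h else 0

/-- The family `(T t)_{t ≥ 0}` is a `C₀`-semigroup (values at negative times are irrelevant). -/
structure IsC0Semigroup (T : ℝ → X →L[ℂ] X) : Prop where
  map_zero : T 0 = 1
  map_add : ∀ s t : ℝ, 0 ≤ s → 0 ≤ t → T (s + t) = T s * T t
  tendsto_zero : ∀ x : X, Tendsto (fun t => T t x) (𝓝[>] 0) (𝓝 x)

/-- `A` (with its domain) is the generator of the `C₀`-semigroup `T`. -/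
structure IsGeneratorOf (A : X →ₗ.[ℂ] X) (T : ℝ → X →L[ℂ] X) : Prop where
  isC0Semigroup : IsC0Semigroup T
  mem_graph_iff : ∀ x y : X, (x, y) ∈ A.graph ↔
    Tendsto (fun t : ℝ => (t : ℂ)⁻¹ • (T t x - x)) (𝓝[>] 0) (𝓝 y)

/-- Semi-uniform stability of the semigroup `T` with generator `A`: uniform boundedness and
`‖T(t) R(1,A)‖ → 0`. -/
structure IsSemiUniformlyStable (A : X →ₗ.[ℂ] X) (T : ℝ → X →L[ℂ] X) : Prop where
  bounded : ∃ M : ℝ, ∀ t : ℝ, 0 ≤ t → ‖T t‖ ≤ M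
  one_mem : (1 : ℂ) ∈ resolventSet A
  tendsto_zero : Tendsto (fun t : ℝ => ‖T t * resolventOp A 1‖) atTop (𝓝 0)

/-- Polynomial stability with parameter `α > 0` of the semigroup `T` with generator `A`:
semi-uniform stability and `‖T(t) A⁻¹‖ = O(t^{-1/α})`, where `A⁻¹ = -R(0,A)`. -/
structure IsPolynomiallyStable (A : X →ₗ.[ℂ] X) (T : ℝ → X →L[ℂ] X) (α : ℝ) : Prop where
  pos : 0 < α
  semiUniformlyStable : IsSemiUniformlyStable A T
  zero_mem : (0 : ℂ) ∈ resolventSet A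
  isBigO : (fun t : ℝ => ‖T t * -resolventOp A 0‖) =O[atTop] fun t : ℝ => t ^ (-(1 / α))

/-- The negative fractional power `(-A)^{-α}`, `α > 0`, of an invertible sectorial operator `-A`,
by the Balakrishnan–Komatsu integral, with `n = ⌊α⌋ + 1`,
`Γ(n) / (Γ(α) Γ(n - α)) ∫₀^∞ t^{n-α-1} (t I - A)^{-n} dt`.
The integral converges in operator norm when `0 ∈ ϱ(A)` and `t ‖R(t,A)‖` is bounded for `t > 0`,
in particular when `A` generates a bounded semigroup and `0 ∈ ϱ(A)`. -/
def negPowNeg (A : X →ₗ.[ℂ] X) (α : ℝ) : X →L[ℂ] X :=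
  ((Real.Gamma (⌊α⌋₊ + 1) / (Real.Gamma α * Real.Gamma (⌊α⌋₊ + 1 - α)) : ℝ) : ℂ) •
    ∫ t in Ioi (0 : ℝ),
      ((t ^ ((⌊α⌋₊ + 1 : ℝ) - α - 1) : ℝ) : ℂ) • resolventOp A (t : ℂ) ^ (⌊α⌋₊ + 1)

/-- The fractional power `(-A)^α`, `α > 0`, of an invertible sectorial operator `-A`: the (unbounded)
inverse of the injective bounded operator `(-A)^{-α}`, with domain `ran ((-A)^{-α})`. -/
def negPow (A : X →ₗ.[ℂ] X) (α : ℝ) : X →ₗ.[ℂ] X :=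
  ((negPowNeg A α : X →ₗ[ℂ] X).toPMap ⊤).inverse

end Operators

section Diagonalizable

variable {X : Type*} [NormedAddCommGroup X] [InnerProductSpace ℂ X]

/-- A Riesz basis: the preimage of the canonical orthonormal basis of `ℓ²(ℕ)` under a bounded
linear operator with bounded inverse. -/
def IsRieszBasis (φ : ℕ → X) : Prop :=
  ∃ Q : X ≃L[ℂ] lp (fun _ : ℕ => ℂ) 2, ∀ n, Q (φ n) = lp.single 2 n (1 : ℂ)

/-- `v` is an eigenvector of the operator `A`. -/
def IsEigenvector (A : X →ₗ.[ℂ] X) (v : X) : Prop :=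
  v ≠ 0 ∧ ∃ lam : ℂ, (v, lam • v) ∈ A.graph

/-- Diagonalizable operators: nonempty resolvent set and a Riesz basis of eigenvectors. -/
def IsDiagonalizable (A : X →ₗ.[ℂ] X) : Prop :=
  (resolventSet A).Nonempty ∧ ∃ φ : ℕ → X, IsRieszBasis φ ∧ ∀ n, IsEigenvector A (φ n)

end Diagonalizable

section Systems

variable {X : Type*} [NormedAddCommGroup X] [NormedSpace ℂ X]
variable {U : Type*} [NormedAddCommGroup U] [NormedSpace ℂ U]

/-- The input space `L^∞(ℝ₊, U)`, with the essential supremum norm. -/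
abbrev Input (U : Type*) [NormedAddCommGroup U] : Type _ :=
  Lp U ∞ (volume.restrict (Ici (0 : ℝ)))

/-- `x` is a mild solution on `[0,∞)` of `ẋ = A x + F(x,u)`, `x(0) = x₀`, where `T` is the semigroup
generated by `A`. -/
structure IsMildSolution (T : ℝ → X →L[ℂ] X) (F : X → U → X) (x₀ : X) (u : Input U)
    (x : ℝ → X) : Prop where
  continuousOn : ContinuousOn x (Ici 0)
  integrable : ∀ τ : ℝ, 0 < τ → IntegrableOn (fun s => F (x s) (u s)) (Icc 0 τ)
  eq : ∀ t : ℝ, 0 ≤ t → x t = T t x₀ + ∫ s in (0 : ℝ)..t, T (t - s) (F (x s) (u s))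

/-- Forward completeness: existence and uniqueness of the mild solution on `[0,∞)` for all
initial states and inputs. -/
def IsForwardComplete (T : ℝ → X →L[ℂ] X) (F : X → U → X) : Prop :=
  ∀ (x₀ : X) (u : Input U), ∃ x : ℝ → X, IsMildSolution T F x₀ u x ∧
    ∀ y : ℝ → X, IsMildSolution T F x₀ u y → EqOn y x (Ici 0)

/-- Uniform global stability. -/
structure IsUGS (T : ℝ → X →L[ℂ] X) (F : X → U → X) : Prop where
  forwardComplete : IsForwardComplete T F
  bound : ∃ γ μ : ℝ≥0 → ℝ≥0, IsClassKInf γ ∧ IsClassKInf μ ∧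
    ∀ (x₀ : X) (u : Input U) (x : ℝ → X), IsMildSolution T F x₀ u x →
      ∀ t : ℝ≥0, ‖x t‖₊ ≤ γ ‖x₀‖₊ + μ ‖u‖₊

/-- Polynomial input-to-state stability with parameter `α > 0` of `ẋ = A x + F(x,u)`, where `T` is
the semigroup generated by `A`; here `‖x₀‖ + ‖A x₀‖` is the graph norm of `x₀ ∈ D(A)`. -/
structure IsPolyISS (A : X →ₗ.[ℂ] X) (T : ℝ → X →L[ℂ] X) (F : X → U → X) (α : ℝ) : Prop where
  pos : 0 < α
  ugs : IsUGS T F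
  bound : ∃ (κ : ℝ≥0 → ℝ≥0 → ℝ≥0) (μ : ℝ≥0 → ℝ≥0), IsClassKL κ ∧ IsClassKInf μ ∧
    (∀ (x₀ : A.domain) (u : Input U) (x : ℝ → X), IsMildSolution T F (x₀ : X) u x →
      ∀ t : ℝ≥0, ‖x t‖₊ ≤ κ (‖(x₀ : X)‖₊ + ‖A x₀‖₊) t + μ ‖u‖₊) ∧
    ∀ r : ℝ≥0, 0 < r →
      (fun t : ℝ≥0 => (κ r t : ℝ)) =O[atTop] fun t : ℝ≥0 => (t : ℝ) ^ (-(1 / α))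

/-- Polynomial input-to-state stability with parameter `α` of the linear system
`ẋ = A x + B u`, where `T` is the semigroup generated by `A`. -/
def IsLinPolyISS (A : X →ₗ.[ℂ] X) (T : ℝ → X →L[ℂ] X) (B : U →L[ℂ] X) (α : ℝ) : Prop :=
  IsPolyISS A T (fun (_ : X) (v : U) => B v) α

end Systems

end

end PolyISS

/-!
In the coordinates of the eigenbasis, with eigenvalues `λᵢ`, the operators `T(t)`, `R(μ, A)` and
`(-A)^{-α}` are multiplications by `e^{tλᵢ}`, `(μ - λᵢ)⁻¹` and a symbol `mᵢ`. Rescaling the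
Balakrishnan integral gives `|mᵢ| ≤ C |λᵢ|^{-α}`, and the decay `‖T(t) A⁻¹‖ = O(t^{-1/α})`, tested
on an eigenvector at time `t = 1 / |Re λᵢ|`, forces `|λᵢ|^{-α} ≤ C |Re λᵢ|`. Write
`B = (-A)^{-α} S` with `S` of finite rank: the coordinates of `S u` are at most `|zᵢ| ‖u‖` for a
single `z ∈ X`, so those of `B u` are at most `C |Re λᵢ| |zᵢ| ‖u‖`. Since
`∫₀ᵗ e^{(t-s) Re λᵢ} ds ≤ 1 / |Re λᵢ|`, the convolution `∫₀ᵗ T(t-s) B u(s) ds` is bounded uniformly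
in `t` by a multiple of `‖u‖_∞`; boundedness and decay of `T` take care of `T(t) x₀`.
-/

namespace PolyISS

section Coordinates

variable {ι : Type*} {p : ℝ≥0∞} [Fact (1 ≤ p)] {X : Type*} [NormedAddCommGroup X] [NormedSpace ℂ X]
  (Q : X ≃L[ℂ] lp (fun _ : ι => ℂ) p)

/-- The `i`-th coordinate functional of `X` with respect to an isomorphism `Q` onto `ℓᵖ(ι)`. -/
noncomputable def coord (i : ι) : X →L[ℂ] ℂ :=
  (lp.evalCLM ℂ (fun _ : ι => ℂ) p i).comp (Q : X →L[ℂ] lp (fun _ : ι => ℂ) p)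

/-- The `i`-th vector of the basis of `X` obtained by pulling the unit vectors of `ℓᵖ(ι)` back along
`Q`. For `p = 2` and `ι = ℕ` these are exactly the Riesz bases of `X`. -/
noncomputable def basisVec [DecidableEq ι] (i : ι) : X :=
  Q.symm (lp.single p i (1 : ℂ))

/-- The condition number `‖Q⁻¹‖ ‖Q‖`, by which bounds in `ℓᵖ(ι)` deteriorate when they are
transferred to `X`. -/
noncomputable def condNumber : ℝ :=
  ‖(Q.symm : lp (fun _ : ι => ℂ) p →L[ℂ] X)‖ * ‖(Q : X →L[ℂ] lp (fun _ : ι => ℂ) p)‖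

/-- The operator `S` acts on coordinates as multiplication by the symbol `d`. -/
def IsDiagonalOp (d : ι → ℂ) (S : X →L[ℂ] X) : Prop :=
  ∀ x i, coord Q i (S x) = d i * coord Q i x

/-- The map `S` sends the unit ball into an order interval `{x | ∀ i, |xᵢ| ≤ |zᵢ|}` of the Banach
lattice `ℓᵖ(ι)`. -/
def IsOrderBounded {U : Type*} [Norm U] (S : U → X) : Prop :=
  ∃ z, ∀ u i, ‖coord Q i (S u)‖ ≤ ‖u‖ * ‖coord Q i z‖

theorem completeSpace_of_equiv_lp (Q : X ≃L[ℂ] lp (fun _ : ι => ℂ) p) : CompleteSpace X :=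
  (completeSpace_congr (e := Q.toEquiv) Q.isUniformEmbedding).2 inferInstance

variable {Q}

theorem condNumber_nonneg : 0 ≤ condNumber Q := by
  unfold condNumber
  positivity

theorem coord_apply (i : ι) (x : X) : coord Q i x = (Q x : ι → ℂ) i :=
  rfl

theorem ext_coord {x y : X} (h : ∀ i, coord Q i x = coord Q i y) : x = y :=
  Q.injective (lp.ext (funext h))

theorem exists_coord_eq {f : ι → ℂ} (hf : Memℓp f p) : ∃ x, ∀ i, coord Q i x = f i :=
  ⟨Q.symm ⟨f, hf⟩, fun i => by rw [coord_apply, Q.apply_symm_apply]⟩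

theorem norm_le_of_norm_coord_le {x y : X} {c : ℝ} (hc : 0 ≤ c)
    (h : ∀ i, ‖coord Q i y‖ ≤ c * ‖coord Q i x‖) : ‖y‖ ≤ condNumber Q * c * ‖x‖ := by
  have hp : p ≠ 0 := (zero_lt_one.trans_le Fact.out).ne'
  have hQ : ‖Q y‖ ≤ c * ‖Q x‖ := by
    have hmono : ‖Q y‖ ≤ ‖(c : ℂ) • Q x‖ := by
      refine lp.norm_mono hp fun i => ?_
      rw [lp.coeFn_smul, Pi.smul_apply, norm_smul, Complex.norm_of_nonneg hc]
      exact h i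
    rwa [norm_smul, Complex.norm_of_nonneg hc] at hmono
  calc ‖y‖ = ‖(Q.symm : lp (fun _ : ι => ℂ) p →L[ℂ] X) (Q y)‖ := by simp
    _ ≤ ‖(Q.symm : lp (fun _ : ι => ℂ) p →L[ℂ] X)‖ * ‖Q y‖ := ContinuousLinearMap.le_opNorm _ _
    _ ≤ ‖(Q.symm : lp (fun _ : ι => ℂ) p →L[ℂ] X)‖ *
        (c * (‖(Q : X →L[ℂ] lp (fun _ : ι => ℂ) p)‖ * ‖x‖)) := by
      gcongr
      exact hQ.trans (by gcongr; exact (Q : X →L[ℂ] lp (fun _ : ι => ℂ) p).le_opNorm x)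
    _ = condNumber Q * c * ‖x‖ := by unfold condNumber; ring

theorem exists_isDiagonalOp {d : ι → ℂ} {c : ℝ} (hc : 0 ≤ c) (hd : ∀ i, ‖d i‖ ≤ c) :
    ∃ S, IsDiagonalOp Q d S := by
  have hle : ∀ x i, ‖d i * coord Q i x‖ ≤ c * ‖coord Q i x‖ := fun x i => by
    rw [norm_mul]
    gcongr
    exact hd i
  have hex : ∀ x, ∃ y, ∀ i, coord Q i y = d i * coord Q i x := fun x =>
    exists_coord_eq <| ((lp.memℓp (Q x)).const_mul (c : ℂ)).mono' fun i => by
      rw [norm_mul (c : ℂ), Complex.norm_of_nonneg hc]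
      exact hle x i
  choose S hS using hex
  let L : X →ₗ[ℂ] X :=
    { toFun := S
      map_add' := fun x y => ext_coord (Q := Q) fun i => by simp only [hS, map_add, mul_add]
      map_smul' := fun a x => ext_coord (Q := Q) fun i => by
        simp only [hS, map_smul, smul_eq_mul, RingHom.id_apply, mul_left_comm] }
  exact ⟨L.mkContinuous (condNumber Q * c) fun x =>
    norm_le_of_norm_coord_le hc fun i => (congrArg norm (hS x i)).trans_le (hle x i), hS⟩

theorem exists_norm_coord_eq_sum {κ : Type*} [Fintype κ] (x : κ → X) :
    ∃ z, ∀ i, ‖coord Q i z‖ = ∑ j, ‖coord Q i (x j)‖ := by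
  have hsum : Memℓp (fun i => ∑ j, ‖coord Q i (x j)‖) p :=
    Memℓp.finsetSum (E := fun _ : ι => ℝ) Finset.univ (f := fun j i => ‖coord Q i (x j)‖)
      fun j _ => memℓp_norm_iff.2 (lp.memℓp (Q (x j)))
  have hmem : Memℓp (fun i => ((∑ j, ‖coord Q i (x j)‖ : ℝ) : ℂ)) p :=
    hsum.mono' fun i => (Complex.norm_real _).le
  obtain ⟨z, hz⟩ := exists_coord_eq (Q := Q) hmem
  exact ⟨z, fun i => by rw [hz, Complex.norm_of_nonneg (by positivity)]⟩

theorem isOrderBounded_of_finiteDimensional_range {U : Type*} [NormedAddCommGroup U]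
    [NormedSpace ℂ U] (S : U →L[ℂ] X)
    [FiniteDimensional ℂ (LinearMap.range (S : U →ₗ[ℂ] X))] : IsOrderBounded Q S := by
  let V := LinearMap.range (S : U →ₗ[ℂ] X)
  let b := Module.finBasis ℂ V
  let f := fun j => (LinearMap.toContinuousLinearMap (b.coord j)).comp
    (S.codRestrict V fun u => ⟨u, rfl⟩)
  have hS : ∀ u, S u = ∑ j, f j u • (b j : X) := fun u => by
    have hrepr := congrArg Subtype.val (b.sum_repr ⟨S u, u, rfl⟩)
    rw [Submodule.coe_sum] at hrepr
    exact hrepr.symm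
  obtain ⟨z, hz⟩ := exists_norm_coord_eq_sum (Q := Q) fun j => (‖f j‖ : ℂ) • (b j : X)
  refine ⟨z, fun u i => ?_⟩
  calc ‖coord Q i (S u)‖ = ‖∑ j, f j u * coord Q i (b j)‖ := by
        rw [hS, map_sum]
        simp only [map_smul, smul_eq_mul]
    _ ≤ ∑ j, ‖f j u‖ * ‖coord Q i (b j)‖ :=
        (norm_sum_le _ _).trans_eq (by simp only [norm_mul])
    _ ≤ ∑ j, (‖f j‖ * ‖u‖) * ‖coord Q i (b j)‖ := by
        gcongr with j
        exact (f j).le_opNorm u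
    _ = ‖u‖ * ‖coord Q i z‖ := by
        rw [hz, Finset.mul_sum]
        refine Finset.sum_congr rfl fun j _ => ?_
        rw [map_smul, norm_smul, Complex.norm_real, norm_norm]
        ring

namespace IsDiagonalOp

theorem opNorm_le {d : ι → ℂ} {S : X →L[ℂ] X} (hS : IsDiagonalOp Q d S) {c : ℝ} (hc : 0 ≤ c)
    (hd : ∀ i, ‖d i‖ ≤ c) : ‖S‖ ≤ condNumber Q * c := by
  refine S.opNorm_le_bound (mul_nonneg condNumber_nonneg hc) fun x =>
    norm_le_of_norm_coord_le hc fun i => ?_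
  rw [hS, norm_mul]
  gcongr
  exact hd i

end IsDiagonalOp

variable [DecidableEq ι]

theorem coord_basisVec (i j : ι) :
    coord Q i (basisVec Q j) = Pi.single (M := fun _ => ℂ) j 1 i := by
  rw [coord_apply, basisVec, Q.apply_symm_apply, lp.coeFn_single]

theorem basisVec_ne_zero (i : ι) : basisVec Q i ≠ 0 := fun h => by
  have := coord_basisVec (Q := Q) i i
  rw [h] at this
  simp at this

theorem isDiagonalOp_of_apply_basisVec (hp : p ≠ ∞) {d : ι → ℂ} {S : X →L[ℂ] X}
    (hS : ∀ i, S (basisVec Q i) = d i • basisVec Q i) : IsDiagonalOp Q d S := by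
  intro x i
  have hcomp : ((coord Q i).comp S).comp (Q.symm : lp (fun _ : ι => ℂ) p →L[ℂ] X) =
      (d i • coord Q i).comp (Q.symm : lp (fun _ : ι => ℂ) p →L[ℂ] X) := by
    refine lp.ext_continuousLinearMap hp fun j => ContinuousLinearMap.ext_ring ?_
    change coord Q i (S (basisVec Q j)) = d i * coord Q i (basisVec Q j)
    rw [hS, map_smul, smul_eq_mul, coord_basisVec]
    obtain rfl | hij := eq_or_ne i j
    · rfl
    · simp [hij]
  simpa using! DFunLike.congr_fun hcomp (Q x)

end Coordinates

theorem exists_finiteRank_factorization {𝕜 U X Y : Type*} [NontriviallyNormedField 𝕜]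
    [CompleteSpace 𝕜] [NormedAddCommGroup U] [NormedSpace 𝕜 U] [NormedAddCommGroup X]
    [NormedSpace 𝕜 X] [NormedAddCommGroup Y] [NormedSpace 𝕜 Y] (B : U →L[𝕜] X) (N : Y →ₗ[𝕜] X)
    [FiniteDimensional 𝕜 (LinearMap.range (B : U →ₗ[𝕜] X))]
    (hle : LinearMap.range (B : U →ₗ[𝕜] X) ≤ LinearMap.range N) :
    ∃ S : U →L[𝕜] Y, FiniteDimensional 𝕜 (LinearMap.range (S : U →ₗ[𝕜] Y)) ∧
      ∀ u, N (S u) = B u := by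
  let V := LinearMap.range (B : U →ₗ[𝕜] X)
  obtain ⟨g, hg⟩ := N.rangeRestrict.exists_rightInverse_of_surjective N.range_rangeRestrict
  let h : V →ₗ[𝕜] Y := g ∘ₗ Submodule.inclusion hle
  have hNh : ∀ v : V, N (h v) = v := fun v =>
    congrArg Subtype.val (DFunLike.congr_fun hg (Submodule.inclusion hle v))
  refine ⟨(LinearMap.toContinuousLinearMap h).comp (B.codRestrict V fun u => ⟨u, rfl⟩), ?_,
    fun u => hNh _⟩
  exact Submodule.finiteDimensional_of_le (LinearMap.range_comp_le_range _ h)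

section Resolvent

variable {X : Type*} [NormedAddCommGroup X] [NormedSpace ℂ X] {A : X →ₗ.[ℂ] X} {μ ν : ℂ}

theorem resolventOp_spec (h : μ ∈ resolventSet A) : IsResolventAt A μ (resolventOp A μ) := by
  rw [resolventOp, dif_pos h]
  exact Classical.choose_spec h

namespace IsResolventAt

variable {R S : X →L[ℂ] X}

theorem apply_smul_sub (hR : IsResolventAt A μ R) {x y : X} (hxy : (x, y) ∈ A.graph) :
    R (μ • x - y) = x := by
  obtain ⟨x', rfl, rfl⟩ := (LinearPMap.mem_graph_iff A).1 hxy
  exact hR.2 x'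

theorem sub_eq_smul_mul (hR : IsResolventAt A μ R) (hS : IsResolventAt A ν S) :
    R - S = (ν - μ) • (R * S) := by
  ext x
  have h := hR.apply_smul_sub (hS.1 x)
  simp only [map_sub, map_smul] at h
  rw [_root_.sub_apply, _root_.smul_apply, mul_apply_eq_comp]
  linear_combination (norm := module) h

variable {v : X} {lam : ℂ}

theorem sub_smul_apply_eigenvector (hR : IsResolventAt A μ R) (hv : (v, lam • v) ∈ A.graph) :
    (μ - lam) • R v = v := by
  rw [← map_smul, sub_smul, hR.apply_smul_sub hv]

theorem ne_eigenvalue (hR : IsResolventAt A μ R) (hv₀ : v ≠ 0) (hv : (v, lam • v) ∈ A.graph) :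
    μ ≠ lam := by
  rintro rfl
  exact hv₀ (by simpa using (hR.sub_smul_apply_eigenvector hv).symm)

theorem apply_eigenvector (hR : IsResolventAt A μ R) (hv : (v, lam • v) ∈ A.graph) :
    R v = (μ - lam)⁻¹ • v := by
  obtain rfl | hv₀ := eq_or_ne v 0
  · simp
  · rw [eq_inv_smul_iff₀ (sub_ne_zero.2 (hR.ne_eigenvalue hv₀ hv)),
      hR.sub_smul_apply_eigenvector hv]

theorem pow_apply_eigenvector (hR : IsResolventAt A μ R) (hv : (v, lam • v) ∈ A.graph) (k : ℕ) :
    (R ^ k) v = ((μ - lam)⁻¹) ^ k • v := by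
  induction k with
  | zero => simp
  | succ k ih =>
    rw [pow_succ, mul_apply_eq_comp, hR.apply_eigenvector hv, map_smul, ih, smul_smul,
      pow_succ']

end IsResolventAt

section Real

variable {K : ℝ}

theorem norm_resolventOp_le (h₀ : (0 : ℂ) ∈ resolventSet A)
    (hpos : ∀ t : ℝ, 0 < t → (t : ℂ) ∈ resolventSet A)
    (hK : ∀ t : ℝ, 0 < t → ‖resolventOp A (t : ℂ)‖ ≤ K * t⁻¹) {t : ℝ} (ht : 0 < t) :
    ‖resolventOp A (t : ℂ)‖ ≤ (1 + K) * (1 + ‖resolventOp A 0‖) * (max t 1)⁻¹ := by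
  have hK₀ : 0 ≤ K := by simpa using (norm_nonneg _).trans (hK 1 one_pos)
  rcases le_total 1 t with h | h
  · rw [max_eq_left h]
    refine (hK t ht).trans ?_
    gcongr
    nlinarith [norm_nonneg (resolventOp A 0)]
  · have hres := (resolventOp_spec (hpos t ht)).sub_eq_smul_mul (resolventOp_spec h₀)
    rw [sub_eq_iff_eq_add, zero_sub] at hres
    have hle : t * ‖resolventOp A (t : ℂ)‖ ≤ K :=
      (mul_le_mul_of_nonneg_left (hK t ht) ht.le).trans_eq (by field_simp)
    rw [max_eq_right h, inv_one, mul_one]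
    calc ‖resolventOp A (t : ℂ)‖
        ≤ ‖-(t : ℂ) • (resolventOp A (t : ℂ) * resolventOp A 0)‖ + ‖resolventOp A 0‖ :=
          (congrArg norm hres).trans_le (norm_add_le _ _)
      _ ≤ t * (‖resolventOp A (t : ℂ)‖ * ‖resolventOp A 0‖) + ‖resolventOp A 0‖ := by
          rw [norm_smul, norm_neg, Complex.norm_of_nonneg ht.le]
          gcongr
          exact norm_mul_le _ _
      _ ≤ K * ‖resolventOp A 0‖ + ‖resolventOp A 0‖ := by
          rw [← mul_assoc]
          gcongr
      _ ≤ (1 + K) * (1 + ‖resolventOp A 0‖) := by linarith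

theorem continuousOn_resolventOp (h₀ : (0 : ℂ) ∈ resolventSet A)
    (hpos : ∀ t : ℝ, 0 < t → (t : ℂ) ∈ resolventSet A)
    (hK : ∀ t : ℝ, 0 < t → ‖resolventOp A (t : ℂ)‖ ≤ K * t⁻¹) :
    ContinuousOn (fun t : ℝ => resolventOp A (t : ℂ)) (Ioi 0) := by
  set C := (1 + K) * (1 + ‖resolventOp A 0‖)
  have hC : ∀ t : ℝ, 0 < t → ‖resolventOp A (t : ℂ)‖ ≤ C := fun t ht => by
    have h := norm_resolventOp_le h₀ hpos hK ht
    have hC₀ : 0 ≤ C := nonneg_of_mul_nonneg_left ((norm_nonneg _).trans h) (by positivity)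
    exact h.trans (mul_le_of_le_one_right hC₀ (inv_le_one_of_one_le₀ (le_max_right _ _)))
  refine (LipschitzOnWith.of_dist_le_mul (K := (C * C).toNNReal) fun s hs t ht => ?_).continuousOn
  rw [dist_eq_norm, (resolventOp_spec (hpos s hs)).sub_eq_smul_mul (resolventOp_spec (hpos t ht)),
    norm_smul, ← Complex.ofReal_sub, Complex.norm_real, dist_comm, Real.dist_eq, mul_comm,
    Real.norm_eq_abs, Real.coe_toNNReal _ (mul_self_nonneg C)]
  gcongr
  exact (norm_mul_le _ _).trans
    (mul_le_mul (hC s hs) (hC t ht) (norm_nonneg _) ((norm_nonneg _).trans (hC s hs)))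

end Real

end Resolvent

section Eigenbasis

variable {ι : Type*} [DecidableEq ι] {p : ℝ≥0∞} [Fact (1 ≤ p)]
  {X : Type*} [NormedAddCommGroup X] [NormedSpace ℂ X]

/-- The basis of `X` given by `Q` consists of eigenvectors of `A`, the `i`-th one for the eigenvalue
`lam i`. -/
def HasEigenbasis (A : X →ₗ.[ℂ] X) (Q : X ≃L[ℂ] lp (fun _ : ι => ℂ) p) (lam : ι → ℂ) : Prop :=
  ∀ i, (basisVec Q i, lam i • basisVec Q i) ∈ A.graph

variable {A : X →ₗ.[ℂ] X} {Q : X ≃L[ℂ] lp (fun _ : ι => ℂ) p} {lam : ι → ℂ}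

theorem HasEigenbasis.isDiagonalOp_of_isResolventAt (hb : HasEigenbasis A Q lam) (hp : p ≠ ∞)
    {μ : ℂ} {R : X →L[ℂ] X} (hR : IsResolventAt A μ R) :
    IsDiagonalOp Q (fun i => (μ - lam i)⁻¹) R :=
  isDiagonalOp_of_apply_basisVec hp fun i => hR.apply_eigenvector (hb i)

theorem HasEigenbasis.mem_resolventSet (hb : HasEigenbasis A Q lam) (hp : p ≠ ∞)
    (hne : (resolventSet A).Nonempty) {μ : ℂ} {δ : ℝ} (hδ : 0 < δ)
    (hsep : ∀ i, δ ≤ ‖μ - lam i‖) : μ ∈ resolventSet A := by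
  obtain ⟨μ₀, R₀, hR₀⟩ := hne
  have hdiag₀ := hb.isDiagonalOp_of_isResolventAt hp hR₀
  have hμ₀ : ∀ i, μ₀ - lam i ≠ 0 := fun i =>
    sub_ne_zero.2 (hR₀.ne_eigenvalue (basisVec_ne_zero i) (hb i))
  have hμ : ∀ i, μ - lam i ≠ 0 := fun i => norm_pos_iff.1 (hδ.trans_le (hsep i))
  obtain ⟨R, hR⟩ := exists_isDiagonalOp (Q := Q) (d := fun i => (μ - lam i)⁻¹) (c := δ⁻¹)
    (by positivity) fun i => by
      rw [norm_inv]
      exact inv_anti₀ hδ (hsep i)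
  refine ⟨R, fun x => ?_, fun x => ?_⟩
  · have hRx : R₀ (x + (μ₀ - μ) • R x) = R x := ext_coord fun i => by
      rw [hdiag₀, map_add, map_smul, hR, smul_eq_mul]
      have := hμ₀ i
      have := hμ i
      field_simp
      ring
    have hgraph := hR₀.1 (x + (μ₀ - μ) • R x)
    rw [hRx] at hgraph
    convert hgraph using 2
    module
  · set w := μ₀ • (x : X) - A x with hw
    have hx : R₀ w = x := hR₀.2 x
    have hμx : μ • (x : X) - A x = w + (μ - μ₀) • R₀ w := by
      rw [hx, hw]
      module
    rw [hμx, ← hx]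
    refine ext_coord (Q := Q) fun i => ?_
    rw [hR, map_add, map_smul, hdiag₀, smul_eq_mul]
    have := hμ₀ i
    have := hμ i
    field_simp
    ring

theorem IsDiagonalizable.exists_hasEigenbasis {X : Type*} [NormedAddCommGroup X]
    [InnerProductSpace ℂ X] {A : X →ₗ.[ℂ] X} (hA : IsDiagonalizable A) :
    ∃ (Q : X ≃L[ℂ] lp (fun _ : ℕ => ℂ) 2) (lam : ℕ → ℂ), HasEigenbasis A Q lam := by
  obtain ⟨-, φ, ⟨Q, hQ⟩, hφ⟩ := hA
  choose _ lam hlam using hφ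
  refine ⟨Q, lam, fun n => ?_⟩
  have hbasis : basisVec Q n = φ n := by
    rw [basisVec, ← hQ, Q.symm_apply_apply]
  exact hbasis ▸ hlam n

end Eigenbasis

section FractionalPower

theorem max_norm_le_norm_ofReal_sub {t : ℝ} {lam : ℂ} (ht : 0 ≤ t) (hlam : lam.re ≤ 0) :
    max t ‖lam‖ ≤ ‖(t : ℂ) - lam‖ := by
  refine max_le ?_ ?_
  · have hre := Complex.re_le_norm ((t : ℂ) - lam)
    rw [Complex.sub_re, Complex.ofReal_re] at hre
    linarith
  · rw [Complex.norm_eq_sqrt_sq_add_sq, Complex.norm_eq_sqrt_sq_add_sq]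
    refine Real.sqrt_le_sqrt ?_
    simp only [Complex.sub_re, Complex.ofReal_re, Complex.sub_im, Complex.ofReal_im]
    nlinarith [mul_nonneg ht (neg_nonneg.2 hlam)]

section Majorant

variable {α : ℝ} {n : ℕ}

theorem integrableOn_rpow_mul_inv_max_pow (hα : 0 < α) (hn : α < n) {ρ : ℝ} (hρ : 0 < ρ) :
    IntegrableOn (fun t : ℝ => t ^ ((n : ℝ) - α - 1) * ((max t ρ)⁻¹) ^ n) (Ioi 0) := by
  rw [← Ioc_union_Ioi_eq_Ioi hρ.le]
  refine IntegrableOn.union ?_ ?_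
  · have hint : IntegrableOn (fun t : ℝ => t ^ ((n : ℝ) - α - 1) * (ρ⁻¹) ^ n) (Ioc 0 ρ) :=
      (intervalIntegrable_iff_integrableOn_Ioc_of_le hρ.le).1
        ((intervalIntegral.intervalIntegrable_rpow' (by linarith)).mul_const _)
    exact hint.congr_fun (fun t ht => by simp only [max_eq_right ht.2]) measurableSet_Ioc
  · have hint : IntegrableOn (fun t : ℝ => t ^ (-α - 1)) (Ioi ρ) :=
      integrableOn_Ioi_rpow_of_lt (by linarith) hρ
    refine hint.congr_fun (fun t ht => ?_) measurableSet_Ioi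
    have ht₀ : 0 < t := hρ.trans ht
    simp only [max_eq_left (mem_Ioi.1 ht).le]
    rw [inv_pow, ← Real.rpow_natCast, ← Real.rpow_neg ht₀.le, ← Real.rpow_add ht₀]
    congr 1
    ring

theorem integral_rpow_mul_inv_max_pow {ρ : ℝ} (hρ : 0 < ρ) :
    ∫ t in Ioi (0 : ℝ), t ^ ((n : ℝ) - α - 1) * ((max t ρ)⁻¹) ^ n =
      (∫ t in Ioi (0 : ℝ), t ^ ((n : ℝ) - α - 1) * ((max t 1)⁻¹) ^ n) * ρ ^ (-α) := by
  have hscale : ∀ t ∈ Ioi (0 : ℝ), (ρ * t) ^ ((n : ℝ) - α - 1) * ((max (ρ * t) ρ)⁻¹) ^ n =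
      t ^ ((n : ℝ) - α - 1) * ((max t 1)⁻¹) ^ n * (ρ⁻¹ * ρ ^ (-α)) := fun t ht => by
    have hmax : max (ρ * t) ρ = ρ * max t 1 := by rw [mul_max_of_nonneg _ _ hρ.le, mul_one]
    have hpow : ρ ^ ((n : ℝ) - α - 1) = ρ ^ n * (ρ⁻¹ * ρ ^ (-α)) := by
      rw [← Real.rpow_natCast, ← Real.rpow_neg_one, ← Real.rpow_add hρ, ← Real.rpow_add hρ]
      congr 1
      ring
    rw [hmax, Real.mul_rpow hρ.le (mem_Ioi.1 ht).le, hpow, mul_inv, mul_pow, inv_pow ρ]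
    field_simp
  have hsubst := integral_comp_mul_left_Ioi
    (fun t : ℝ => t ^ ((n : ℝ) - α - 1) * ((max t ρ)⁻¹) ^ n) 0 hρ
  rw [mul_zero, setIntegral_congr_fun measurableSet_Ioi hscale, integral_mul_const, smul_eq_mul,
    mul_left_comm] at hsubst
  exact (mul_left_cancel₀ (inv_ne_zero hρ.ne') hsubst).symm

end Majorant

/-- The symbol `(-lam)^(-α)` of the fractional power `(-A)^(-α)` at an eigenvalue `lam` of `A`, in
the form in which `negPowNeg` produces it: the Balakrishnan–Komatsu integral of scalar resolvents.
-/
noncomputable def negPowSymbol (α : ℝ) (lam : ℂ) : ℂ :=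
  ((Real.Gamma (⌊α⌋₊ + 1) / (Real.Gamma α * Real.Gamma (⌊α⌋₊ + 1 - α)) : ℝ) : ℂ) *
    ∫ t in Ioi (0 : ℝ),
      ((t ^ ((⌊α⌋₊ + 1 : ℝ) - α - 1) : ℝ) : ℂ) * (((t : ℂ) - lam)⁻¹) ^ (⌊α⌋₊ + 1)

theorem exists_norm_negPowSymbol_le {α : ℝ} (hα : 0 < α) : ∃ C, 0 ≤ C ∧
    ∀ lam : ℂ, lam.re ≤ 0 → lam ≠ 0 → ‖negPowSymbol α lam‖ ≤ C * ‖lam‖ ^ (-α) := by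
  set n := ⌊α⌋₊ + 1 with hn
  have hcast : (⌊α⌋₊ + 1 : ℝ) = n := by rw [hn]; push_cast; rfl
  have hαn : α < n := hcast ▸ Nat.lt_floor_add_one α
  refine ⟨‖((Real.Gamma n / (Real.Gamma α * Real.Gamma (n - α)) : ℝ) : ℂ)‖ *
    ∫ t in Ioi (0 : ℝ), t ^ ((n : ℝ) - α - 1) * ((max t 1)⁻¹) ^ n, ?_, fun lam hre hlam => ?_⟩
  · exact mul_nonneg (norm_nonneg _) (setIntegral_nonneg measurableSet_Ioi fun t ht => by
      have := mem_Ioi.1 ht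
      positivity)
  · rw [negPowSymbol, ← hn, hcast, norm_mul, mul_assoc,
      ← integral_rpow_mul_inv_max_pow (norm_pos_iff.2 hlam)]
    refine mul_le_mul_of_nonneg_left (norm_integral_le_of_norm_le
      (integrableOn_rpow_mul_inv_max_pow hα hαn (norm_pos_iff.2 hlam)) ?_) (norm_nonneg _)
    filter_upwards [ae_restrict_mem measurableSet_Ioi] with t ht
    have ht₀ : 0 < t := ht
    rw [norm_mul, Complex.norm_of_nonneg (by positivity), norm_pow, norm_inv]
    gcongr
    exact max_norm_le_norm_ofReal_sub ht₀.le hre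

section Operator

variable {X : Type*} [NormedAddCommGroup X] [NormedSpace ℂ X] {A : X →ₗ.[ℂ] X} {α K : ℝ}

theorem negPow_domain : (negPow A α).domain = LinearMap.range (negPowNeg A α : X →ₗ[ℂ] X) := by
  rw [negPow, LinearPMap.inverse_domain]
  exact Submodule.ext fun x => ⟨fun ⟨y, hy⟩ => ⟨y, hy⟩, fun ⟨y, hy⟩ => ⟨⟨y, trivial⟩, hy⟩⟩

theorem integrableOn_rpow_smul_resolventOp_pow (h₀ : (0 : ℂ) ∈ resolventSet A)
    (hpos : ∀ t : ℝ, 0 < t → (t : ℂ) ∈ resolventSet A)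
    (hK : ∀ t : ℝ, 0 < t → ‖resolventOp A (t : ℂ)‖ ≤ K * t⁻¹) (hα : 0 < α) :
    IntegrableOn (fun t : ℝ => ((t ^ ((⌊α⌋₊ + 1 : ℝ) - α - 1) : ℝ) : ℂ) •
      resolventOp A (t : ℂ) ^ (⌊α⌋₊ + 1)) (Ioi 0) := by
  set n := ⌊α⌋₊ + 1 with hn
  set C := (1 + K) * (1 + ‖resolventOp A 0‖)
  have hcast : (⌊α⌋₊ + 1 : ℝ) = n := by rw [hn]; push_cast; rfl
  have hαn : α < n := hcast ▸ Nat.lt_floor_add_one α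
  have hcont : ContinuousOn (fun t : ℝ => ((t ^ ((n : ℝ) - α - 1) : ℝ) : ℂ) •
      resolventOp A (t : ℂ) ^ n) (Ioi 0) :=
    (Complex.continuous_ofReal.comp_continuousOn (continuousOn_id.rpow_const fun t ht =>
      Or.inl (ne_of_gt ht))).smul ((continuousOn_resolventOp h₀ hpos hK).pow n)
  have hmajorant := (integrableOn_rpow_mul_inv_max_pow hα hαn one_pos).const_mul (C ^ n)
  rw [hcast]
  refine hmajorant.mono' (hcont.aestronglyMeasurable measurableSet_Ioi) ?_
  filter_upwards [ae_restrict_mem measurableSet_Ioi] with t ht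
  have ht₀ : 0 < t := ht
  rw [norm_smul, Complex.norm_of_nonneg (by positivity), mul_left_comm, ← mul_pow]
  gcongr
  exact (norm_pow_le' _ (Nat.succ_pos ⌊α⌋₊)).trans
    (pow_le_pow_left₀ (norm_nonneg _) (norm_resolventOp_le h₀ hpos hK ht₀) n)

theorem negPowNeg_apply_eigenvector [CompleteSpace X] (h₀ : (0 : ℂ) ∈ resolventSet A)
    (hpos : ∀ t : ℝ, 0 < t → (t : ℂ) ∈ resolventSet A)
    (hK : ∀ t : ℝ, 0 < t → ‖resolventOp A (t : ℂ)‖ ≤ K * t⁻¹) (hα : 0 < α) {v : X} {lam : ℂ}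
    (hv : (v, lam • v) ∈ A.graph) : negPowNeg A α v = negPowSymbol α lam • v := by
  rw [negPowNeg, negPowSymbol, _root_.smul_apply, mul_smul, ContinuousLinearMap.integral_apply
    (integrableOn_rpow_smul_resolventOp_pow h₀ hpos hK hα), ← integral_smul_const]
  congr 1
  refine setIntegral_congr_fun measurableSet_Ioi fun t ht => ?_
  simp only [_root_.smul_apply]
  rw [(resolventOp_spec (hpos t ht)).pow_apply_eigenvector hv, smul_smul]

theorem HasEigenbasis.isDiagonalOp_negPowNeg {ι : Type*} [DecidableEq ι] {p : ℝ≥0∞}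
    [Fact (1 ≤ p)] {Q : X ≃L[ℂ] lp (fun _ : ι => ℂ) p} {lam : ι → ℂ} (hb : HasEigenbasis A Q lam)
    (hp : p ≠ ∞) (h₀ : (0 : ℂ) ∈ resolventSet A) (hre : ∀ i, (lam i).re ≤ 0) (hα : 0 < α) :
    IsDiagonalOp Q (fun i => negPowSymbol α (lam i)) (negPowNeg A α) := by
  have : CompleteSpace X := completeSpace_of_equiv_lp Q
  have hsep : ∀ t : ℝ, 0 < t → ∀ i, t ≤ ‖(t : ℂ) - lam i‖ := fun t ht i =>
    (le_max_left _ _).trans (max_norm_le_norm_ofReal_sub ht.le (hre i))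
  have hpos : ∀ t : ℝ, 0 < t → (t : ℂ) ∈ resolventSet A := fun t ht =>
    hb.mem_resolventSet hp ⟨0, h₀⟩ ht (hsep t ht)
  have hnorm : ∀ t : ℝ, 0 < t → ‖resolventOp A (t : ℂ)‖ ≤ condNumber Q * t⁻¹ := fun t ht =>
    (hb.isDiagonalOp_of_isResolventAt hp (resolventOp_spec (hpos t ht))).opNorm_le
      (by positivity) fun i => by
        rw [norm_inv]
        exact inv_anti₀ ht (hsep t ht i)
  exact isDiagonalOp_of_apply_basisVec hp fun i =>
    negPowNeg_apply_eigenvector h₀ hpos hnorm hα (hb i)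

end Operator

end FractionalPower

section Semigroup

variable {X : Type*} [NormedAddCommGroup X] [NormedSpace ℂ X] {T : ℝ → X →L[ℂ] X} {M : ℝ}

namespace IsC0Semigroup

theorem continuousWithinAt_zero (hT : IsC0Semigroup T) (x : X) :
    ContinuousWithinAt (fun t => T t x) (Ici 0) 0 := by
  refine continuousWithinAt_Ioi_iff_Ici.1 ?_
  rw [ContinuousWithinAt, hT.map_zero]
  exact hT.tendsto_zero x

theorem norm_sub_le (hT : IsC0Semigroup T) (hM : ∀ t, 0 ≤ t → ‖T t‖ ≤ M) {s t : ℝ} (hs : 0 ≤ s)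
    (ht : 0 ≤ t) (x : X) : ‖T t x - T s x‖ ≤ M * ‖T |t - s| x - x‖ := by
  wlog h : s ≤ t generalizing s t
  · rw [norm_sub_rev, abs_sub_comm]
    exact this ht hs (not_le.1 h).le
  have hadd : T t = T s * T (t - s) := by
    rw [← hT.map_add s (t - s) hs (sub_nonneg.2 h), add_sub_cancel]
  rw [abs_of_nonneg (sub_nonneg.2 h), hadd, mul_apply_eq_comp, ← map_sub]
  exact ((T s).le_opNorm _).trans (by gcongr; exact hM s hs)

theorem continuous_max_zero (hT : IsC0Semigroup T) (hM : ∀ t, 0 ≤ t → ‖T t‖ ≤ M) (x : X) :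
    Continuous fun t : ℝ => T (max 0 t) x := by
  refine continuous_iff_continuousAt.2 fun s => ?_
  have hdist : Tendsto (fun t : ℝ => |max 0 t - max 0 s|) (𝓝 s) (𝓝[≥] 0) := by
    refine tendsto_nhdsWithin_iff.2 ⟨?_, Eventually.of_forall fun t => mem_Ici.2 (abs_nonneg _)⟩
    have hcont : Continuous fun t : ℝ => |max 0 t - max 0 s| := by fun_prop
    simpa using hcont.tendsto s
  have hzero : Tendsto (fun t => M * ‖T |max 0 t - max 0 s| x - x‖) (𝓝 s) (𝓝 0) := by
    have := (((hT.continuousWithinAt_zero x).tendsto.comp hdist).sub_const x).norm.const_mul M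
    simpa [hT.map_zero] using this
  exact tendsto_iff_norm_sub_tendsto_zero.2 <| squeeze_zero (fun t => norm_nonneg _)
    (fun t => hT.norm_sub_le hM (le_max_left _ _) (le_max_left _ _) x) hzero

theorem continuousOn_orbit (hT : IsC0Semigroup T) (hM : ∀ t, 0 ≤ t → ‖T t‖ ≤ M) (x : X) :
    ContinuousOn (fun t => T t x) (Ici 0) :=
  (hT.continuous_max_zero hM x).continuousOn.congr fun t ht => by
    simp only [max_eq_right (mem_Ici.1 ht)]

theorem continuous_uncurry_max_zero (hT : IsC0Semigroup T) (hM : ∀ t, 0 ≤ t → ‖T t‖ ≤ M) :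
    Continuous fun q : ℝ × X => T (max 0 q.1) q.2 :=
  continuous_prod_of_continuous_lipschitzWith' (fun q : ℝ × X => T (max 0 q.1) q.2) M.toNNReal
    (fun t => (T (max 0 t)).lipschitzWith_of_opNorm_le
      ((hM _ (le_max_left _ _)).trans (Real.le_coe_toNNReal M)))
    (hT.continuous_max_zero hM)

end IsC0Semigroup

namespace IsGeneratorOf

variable {A : X →ₗ.[ℂ] X}

theorem hasDerivWithinAt_orbit (hA : IsGeneratorOf A T) {x y : X} (hxy : (x, y) ∈ A.graph) {s : ℝ}
    (hs : 0 ≤ s) : HasDerivWithinAt (fun t => T t x) (T s y) (Ici s) s := by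
  rw [hasDerivWithinAt_iff_tendsto_slope, Ici_sdiff_left]
  have hshift : Tendsto (fun t : ℝ => t - s) (𝓝[>] s) (𝓝[>] 0) := by
    refine tendsto_nhdsWithin_iff.2 ⟨?_, ?_⟩
    · have hcont : Continuous fun t : ℝ => t - s := by fun_prop
      simpa using (hcont.tendsto s).mono_left nhdsWithin_le_nhds
    · filter_upwards [self_mem_nhdsWithin] with t ht using mem_Ioi.2 (sub_pos.2 (mem_Ioi.1 ht))
  refine (((T s).continuous.tendsto y).comp
    (((hA.mem_graph_iff x y).1 hxy).comp hshift)).congr' ?_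
  filter_upwards [self_mem_nhdsWithin] with t ht
  have hadd : T t = T s * T (t - s) := by
    rw [← hA.isC0Semigroup.map_add s (t - s) hs (sub_pos.2 ht).le, add_sub_cancel]
  rw [slope_def_module, hadd, ← Complex.coe_smul, Complex.ofReal_inv]
  simp only [Function.comp_apply, map_smul, map_sub, mul_apply_eq_comp]

theorem apply_eigenvector (hA : IsGeneratorOf A T) (hM : ∀ t, 0 ≤ t → ‖T t‖ ≤ M) {v : X} {lam : ℂ}
    (hv : (v, lam • v) ∈ A.graph) {t : ℝ} (ht : 0 ≤ t) : T t v = Complex.exp (t * lam) • v := by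
  have hT := hA.isC0Semigroup
  have hexp : ∀ s : ℝ, HasDerivAt (fun s : ℝ => Complex.exp (-(s * lam)))
      (-lam * Complex.exp (-(s * lam))) s := fun s => by
    have hlin : HasDerivAt (fun s : ℝ => -((s : ℂ) * lam)) (-lam) s := by
      simpa using ((Complex.ofRealCLM.hasDerivAt (x := s)).mul_const lam).fun_neg
    simpa only [mul_comm] using hlin.cexp
  have hcont : ContinuousOn (fun s : ℝ => Complex.exp (-(s * lam)) • T s v) (Icc 0 t) :=
    ContinuousOn.smul (by fun_prop) ((hT.continuousOn_orbit hM v).mono Icc_subset_Ici_self)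
  have hconst : Complex.exp (-(t * lam)) • T t v = v := by
    have := constant_of_has_deriv_right_zero hcont (fun s hs => by
      refine ((hexp s).hasDerivWithinAt.smul (hA.hasDerivWithinAt_orbit hv hs.1)).congr_deriv ?_
      rw [map_smul]
      module) t ⟨ht, le_rfl⟩
    simpa [hT.map_zero] using this
  calc T t v = Complex.exp (t * lam) • Complex.exp (-(t * lam)) • T t v := by
        rw [smul_smul, ← Complex.exp_add, add_neg_cancel, Complex.exp_zero, one_smul]
    _ = Complex.exp (t * lam) • v := by rw [hconst]

end IsGeneratorOf

end Semigroup

section PolynomialDecay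

theorem exists_norm_le_mul_one_add_rpow {E : Type*} [SeminormedAddCommGroup E] {f : ℝ → E}
    {M β : ℝ} (hβ : 0 ≤ β) (hM : ∀ t, 0 ≤ t → ‖f t‖ ≤ M)
    (hf : f =O[atTop] fun t : ℝ => t ^ (-β)) :
    ∃ K : ℝ, 0 < K ∧ ∀ t : ℝ, 0 ≤ t → ‖f t‖ ≤ K * (1 + t) ^ (-β) := by
  obtain ⟨C, hC, hbound⟩ := hf.exists_pos
  obtain ⟨t₀, ht₀⟩ := eventually_atTop.1 hbound.bound
  set t₁ := max t₀ 1
  have ht₁ : 1 ≤ t₁ := le_max_right _ _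
  have hM₀ : 0 ≤ M := (norm_nonneg _).trans (hM 0 le_rfl)
  refine ⟨max (C * 2 ^ β) (M * (1 + t₁) ^ β), lt_max_of_lt_left (by positivity), fun t ht => ?_⟩
  rw [Real.rpow_neg (by positivity), ← div_eq_mul_inv, le_div_iff₀ (by positivity)]
  rcases le_total t t₁ with h | h
  · calc ‖f t‖ * (1 + t) ^ β ≤ M * (1 + t₁) ^ β := by
          gcongr
          exact hM t ht
      _ ≤ max (C * 2 ^ β) (M * (1 + t₁) ^ β) := le_max_right _ _
  · have htpos : 0 < t := by linarith
    have hft : ‖f t‖ ≤ C * (t ^ β)⁻¹ := by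
      have := ht₀ t ((le_max_left _ _).trans h)
      rwa [Real.norm_of_nonneg (by positivity), Real.rpow_neg ht] at this
    calc ‖f t‖ * (1 + t) ^ β ≤ C * (t ^ β)⁻¹ * (2 * t) ^ β := by
          gcongr
          linarith
      _ = C * 2 ^ β := by
          rw [Real.mul_rpow zero_le_two ht]
          field_simp
      _ ≤ max (C * 2 ^ β) (M * (1 + t₁) ^ β) := le_max_left _ _

section ExpDecay

variable {a r β : ℝ}

theorem neg_of_exp_mul_le_mul_one_add_rpow (hβ : 0 < β)
    (h : ∀ t, 0 ≤ t → Real.exp (t * r) ≤ a * (1 + t) ^ (-β)) : r < 0 := by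
  by_contra! hr
  have hlim : Tendsto (fun t : ℝ => a * (1 + t) ^ (-β)) atTop (𝓝 0) := by
    simpa using ((tendsto_rpow_neg_atTop hβ).comp
      (tendsto_atTop_add_const_left _ 1 tendsto_id)).const_mul a
  have hle : (1 : ℝ) ≤ 0 := by
    refine ge_of_tendsto hlim ?_
    filter_upwards [eventually_ge_atTop 0] with t ht
    exact (Real.one_le_exp (mul_nonneg ht hr)).trans (h t ht)
  exact absurd hle (by norm_num)

theorem one_le_mul_neg_rpow_of_exp_mul_le (hβ : 0 < β)
    (h : ∀ t, 0 ≤ t → Real.exp (t * r) ≤ a * (1 + t) ^ (-β)) :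
    1 ≤ Real.exp 1 * a * (-r) ^ β := by
  have hr : 0 < -r := neg_pos.2 (neg_of_exp_mul_le_mul_one_add_rpow hβ h)
  have ha : 0 ≤ a := by simpa using (Real.exp_pos _).le.trans (h 0 le_rfl)
  have hle : Real.exp (-1) ≤ a * (-r) ^ β :=
    calc Real.exp (-1) = Real.exp ((-r)⁻¹ * r) := by
          rw [inv_neg, neg_mul, inv_mul_cancel₀ (neg_pos.1 hr).ne]
      _ ≤ a * (1 + (-r)⁻¹) ^ (-β) := h _ (by positivity)
      _ ≤ a * ((-r)⁻¹) ^ (-β) := by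
          refine mul_le_mul_of_nonneg_left ?_ ha
          exact Real.rpow_le_rpow_of_nonpos (by positivity) (by linarith) (by linarith)
      _ = a * (-r) ^ β := by rw [Real.inv_rpow hr.le, Real.rpow_neg hr.le, inv_inv]
  rwa [Real.exp_neg, inv_le_iff_one_le_mul₀' (Real.exp_pos 1), ← mul_assoc] at hle

end ExpDecay

end PolynomialDecay

namespace IsPolynomiallyStable

variable {X : Type*} [NormedAddCommGroup X] [NormedSpace ℂ X] {A : X →ₗ.[ℂ] X}
  {T : ℝ → X →L[ℂ] X} {α : ℝ}

theorem exists_norm_apply_le (hstab : IsPolynomiallyStable A T α) : ∃ K : ℝ, 0 < K ∧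
    ∀ (x : A.domain) (t : ℝ), 0 ≤ t → ‖T t x‖ ≤ K * (1 + t) ^ (-(1 / α)) * ‖A x‖ := by
  obtain ⟨M, hM⟩ := hstab.semiUniformlyStable.bounded
  obtain ⟨K, hK, hdecay⟩ := exists_norm_le_mul_one_add_rpow (one_div_pos.2 hstab.pos).le
    (M := M * ‖-resolventOp A 0‖) (fun t ht => (norm_mul_le _ _).trans (by gcongr; exact hM t ht))
    hstab.isBigO.of_norm_left
  refine ⟨K, hK, fun x t ht => ?_⟩
  have hx : (-resolventOp A 0) (A x) = x := by
    simpa using (resolventOp_spec hstab.zero_mem).2 x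
  calc ‖T t x‖ = ‖(T t * -resolventOp A 0) (A x)‖ := by rw [mul_apply_eq_comp, hx]
    _ ≤ ‖T t * -resolventOp A 0‖ * ‖A x‖ := ContinuousLinearMap.le_opNorm _ _
    _ ≤ K * (1 + t) ^ (-(1 / α)) * ‖A x‖ := by
        gcongr
        exact hdecay t ht

theorem exists_eigenvalue_bound (hstab : IsPolynomiallyStable A T α) (hA : IsGeneratorOf A T) :
    ∃ C : ℝ, 0 ≤ C ∧ ∀ (v : X) (lam : ℂ), v ≠ 0 → (v, lam • v) ∈ A.graph →
      lam.re < 0 ∧ ‖lam‖ ^ (-α) ≤ C * -lam.re := by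
  obtain ⟨M, hM⟩ := hstab.semiUniformlyStable.bounded
  obtain ⟨K, hK, hdecay⟩ := hstab.exists_norm_apply_le
  have hα := hstab.pos
  refine ⟨(Real.exp 1 * K) ^ α, by positivity, fun v lam hv₀ hv => ?_⟩
  have hexp : ∀ t, 0 ≤ t → Real.exp (t * lam.re) ≤ K * ‖lam‖ * (1 + t) ^ (-(1 / α)) := by
    intro t ht
    obtain ⟨x, hxv, hAx⟩ := (LinearPMap.mem_graph_iff A).1 hv
    have hle := hdecay x t ht
    simp only at hxv hAx
    rw [hxv, hAx, hA.apply_eigenvector hM hv ht, norm_smul, norm_smul, Complex.norm_exp,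
      Complex.re_ofReal_mul, ← mul_assoc] at hle
    exact (le_of_mul_le_mul_right hle (norm_pos_iff.2 hv₀)).trans_eq (mul_right_comm _ _ _)
  have hre := neg_of_exp_mul_le_mul_one_add_rpow (one_div_pos.2 hα) hexp
  have hlam : 0 < ‖lam‖ := norm_pos_iff.2 fun h => hre.ne (by rw [h, Complex.zero_re])
  have hω : 0 ≤ -lam.re := neg_nonneg.2 hre.le
  refine ⟨hre, ?_⟩
  rw [Real.rpow_neg hlam.le, inv_le_iff_one_le_mul₀ (by positivity)]
  calc (1 : ℝ) = 1 ^ α := (Real.one_rpow α).symm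
    _ ≤ (Real.exp 1 * (K * ‖lam‖) * (-lam.re) ^ (1 / α)) ^ α :=
        Real.rpow_le_rpow zero_le_one (one_le_mul_neg_rpow_of_exp_mul_le (one_div_pos.2 hα) hexp)
          hα.le
    _ = (Real.exp 1 * K) ^ α * -lam.re * ‖lam‖ ^ α := by
        rw [← mul_assoc, Real.mul_rpow (by positivity) (by positivity),
          Real.mul_rpow (by positivity) hlam.le, ← Real.rpow_mul hω, one_div_mul_cancel hα.ne',
          Real.rpow_one, mul_right_comm]

end IsPolynomiallyStable

section Convolution

variable {X : Type*} [NormedAddCommGroup X] [NormedSpace ℂ X] {T : ℝ → X →L[ℂ] X} {M : ℝ}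
  {g : ℝ → X}

theorem integral_convolution_eq {b t : ℝ} (ht : t ∈ Icc 0 b) :
    ∫ s in (0 : ℝ)..t, T (t - s) (g s) =
      ∫ s in Ioc 0 b, (Iic t).indicator (fun s => T (max 0 (t - s)) (g s)) s := by
  rw [setIntegral_indicator measurableSet_Iic, Ioc_inter_Iic, min_eq_right ht.2,
    intervalIntegral.integral_of_le ht.1]
  exact setIntegral_congr_fun measurableSet_Ioc fun s hs => by
    simp only [max_eq_right (sub_nonneg.2 hs.2)]

namespace IsC0Semigroup

theorem integrableOn_max_zero_sub (hT : IsC0Semigroup T) (hM : ∀ t, 0 ≤ t → ‖T t‖ ≤ M) {I : Set ℝ}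
    (hg : IntegrableOn g I) (t : ℝ) : IntegrableOn (fun s => T (max 0 (t - s)) (g s)) I := by
  have hmeas : AEStronglyMeasurable (fun s => T (max 0 (t - s)) (g s)) (volume.restrict I) :=
    (hT.continuous_uncurry_max_zero hM).comp_aestronglyMeasurable
      ((by fun_prop : Continuous fun s : ℝ => t - s).aestronglyMeasurable.prodMk
        hg.aestronglyMeasurable)
  exact (hg.norm.const_mul M).mono' hmeas <| Eventually.of_forall fun s =>
    ((T _).le_opNorm _).trans (by gcongr; exact hM _ (le_max_left _ _))

theorem intervalIntegrable_convolution (hT : IsC0Semigroup T) (hM : ∀ t, 0 ≤ t → ‖T t‖ ≤ M)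
    {t : ℝ} (ht : 0 ≤ t) (hg : IntegrableOn g (Ioc 0 t)) :
    IntervalIntegrable (fun s => T (t - s) (g s)) volume 0 t :=
  (intervalIntegrable_iff_integrableOn_Ioc_of_le ht).2 <|
    (hT.integrableOn_max_zero_sub hM hg t).congr_fun
      (fun s hs => by simp only [max_eq_right (sub_nonneg.2 hs.2)]) measurableSet_Ioc

theorem continuousAt_indicator_max_zero_sub (hT : IsC0Semigroup T)
    (hM : ∀ t, 0 ≤ t → ‖T t‖ ≤ M) {s t₀ : ℝ} (hs : s ≠ t₀) (x : X) :
    ContinuousAt (fun t => (Iic t).indicator (fun s => T (max 0 (t - s)) x) s) t₀ := by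
  rcases hs.lt_or_gt with h | h
  · have hcont : ContinuousAt (fun t => T (max 0 (t - s)) x) t₀ :=
      ((hT.continuous_max_zero hM x).comp (continuous_id.sub continuous_const)).continuousAt
    refine hcont.congr ?_
    filter_upwards [Ioi_mem_nhds h] with t ht
    rw [indicator_of_mem (mem_Iic.2 (mem_Ioi.1 ht).le)]
  · refine (continuousAt_const (y := (0 : X))).congr ?_
    filter_upwards [Iio_mem_nhds h] with t ht
    rw [indicator_of_notMem (notMem_Iic.2 ht)]

theorem continuousOn_convolution (hT : IsC0Semigroup T) (hM : ∀ t, 0 ≤ t → ‖T t‖ ≤ M)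
    (hg : LocallyIntegrableOn g (Ici 0)) :
    ContinuousOn (fun t : ℝ => ∫ s in (0 : ℝ)..t, T (t - s) (g s)) (Ici 0) := by
  intro t₀ ht₀
  have hgb : IntegrableOn g (Ioc 0 (t₀ + 1)) :=
    (hg.integrableOn_compact_subset Icc_subset_Ici_self isCompact_Icc).mono_set Ioc_subset_Icc_self
  have hcont : ContinuousWithinAt (fun t => ∫ s in Ioc 0 (t₀ + 1),
      (Iic t).indicator (fun s => T (max 0 (t - s)) (g s)) s) (Ici 0) t₀ := by
    refine continuousWithinAt_of_dominated (bound := fun s => M * ‖g s‖)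
      (Eventually.of_forall fun t =>
        (hT.integrableOn_max_zero_sub hM hgb t).aestronglyMeasurable.indicator measurableSet_Iic)
      (Eventually.of_forall fun t => Eventually.of_forall fun s =>
        (norm_indicator_le_norm_self _ _).trans <|
          ((T _).le_opNorm _).trans (by gcongr; exact hM _ (le_max_left _ _)))
      (hgb.norm.const_mul M) ?_
    filter_upwards [(volume.restrict (Ioc 0 (t₀ + 1))).ae_ne t₀] with s hs
    exact (hT.continuousAt_indicator_max_zero_sub hM hs (g s)).continuousWithinAt
  refine hcont.congr_of_eventuallyEq ?_ (integral_convolution_eq ⟨ht₀, by linarith⟩)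
  filter_upwards [self_mem_nhdsWithin,
    nhdsWithin_le_nhds (Iic_mem_nhds (lt_add_one t₀))] with t h₀ h₁
  exact integral_convolution_eq ⟨h₀, h₁⟩

end IsC0Semigroup

end Convolution

section MildSolution

variable {X : Type*} [NormedAddCommGroup X] [NormedSpace ℂ X] {U : Type*} [NormedAddCommGroup U]

namespace Input

theorem ae_norm_le (u : Input U) : ∀ᵐ s ∂volume.restrict (Ici (0 : ℝ)), ‖u s‖ ≤ ‖u‖ := by
  have h := ae_le_lpNorm_exponent_top (Lp.memLp u)
  rwa [← toReal_eLpNorm (Lp.aestronglyMeasurable u), ← Lp.norm_def] at h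

theorem locallyIntegrableOn_apply [NormedSpace ℂ U] (u : Input U) (B : U →L[ℂ] X) :
    LocallyIntegrableOn (fun s => B (u s)) (Ici 0) :=
  locallyIntegrableOn_of_locallyIntegrable_restrict <|
    (B.comp_memLp' (Lp.memLp u)).locallyIntegrable le_top

end Input

variable [NormedSpace ℂ U] {T : ℝ → X →L[ℂ] X} {M : ℝ}

theorem isForwardComplete_linear (hT : IsC0Semigroup T) (hM : ∀ t, 0 ≤ t → ‖T t‖ ≤ M)
    (B : U →L[ℂ] X) : IsForwardComplete T fun (_ : X) (v : U) => B v := by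
  intro x₀ u
  have hg := u.locallyIntegrableOn_apply B
  exact ⟨fun t => T t x₀ + ∫ s in (0 : ℝ)..t, T (t - s) (B (u s)),
    { continuousOn := (hT.continuousOn_orbit hM x₀).add (hT.continuousOn_convolution hM hg)
      integrable := fun τ _ => hg.integrableOn_compact_subset Icc_subset_Ici_self isCompact_Icc
      eq := fun t _ => rfl }, fun y hy t ht => hy.eq t ht⟩

end MildSolution

section Admissibility

/-- Infinite-time admissibility of the control operator `B` for bounded inputs: the state reached
from `0` is bounded by a multiple of the input norm, uniformly in time. -/
def IsInfiniteTimeAdmissible {X U : Type*} [NormedAddCommGroup X] [NormedSpace ℂ X]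
    [NormedAddCommGroup U] [NormedSpace ℂ U] (T : ℝ → X →L[ℂ] X) (B : U →L[ℂ] X) : Prop :=
  ∃ C : ℝ, 0 ≤ C ∧ ∀ (u : Input U) (t : ℝ), 0 ≤ t →
    ‖∫ s in (0 : ℝ)..t, T (t - s) (B (u s))‖ ≤ C * ‖u‖

theorem integral_exp_sub_mul_le {r : ℝ} (hr : r < 0) (t : ℝ) :
    ∫ s in (0 : ℝ)..t, Real.exp ((t - s) * r) ≤ (-r)⁻¹ := by
  have hreflect : ∫ s in (0 : ℝ)..t, Real.exp ((t - s) * r) =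
      ∫ s in (0 : ℝ)..t, Real.exp (s * r) := by
    simpa using intervalIntegral.integral_comp_sub_left (fun s => Real.exp (s * r)) t
      (a := 0) (b := t)
  calc ∫ s in (0 : ℝ)..t, Real.exp ((t - s) * r) = (-r)⁻¹ * (1 - Real.exp (t * r)) := by
        rw [hreflect, intervalIntegral.integral_comp_mul_right (fun s => Real.exp s) hr.ne,
          integral_exp, zero_mul, Real.exp_zero, smul_eq_mul, inv_neg]
        ring
    _ ≤ (-r)⁻¹ * 1 := by
        have := neg_pos.2 hr
        gcongr
        linarith [Real.exp_pos (t * r)]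
    _ = (-r)⁻¹ := mul_one _

variable {ι : Type*} [DecidableEq ι] {p : ℝ≥0∞} [Fact (1 ≤ p)]
  {X : Type*} [NormedAddCommGroup X] [NormedSpace ℂ X] {A : X →ₗ.[ℂ] X} {T : ℝ → X →L[ℂ] X}
  {Q : X ≃L[ℂ] lp (fun _ : ι => ℂ) p} {lam : ι → ℂ} {M : ℝ}

namespace HasEigenbasis

theorem isDiagonalOp_semigroup (hb : HasEigenbasis A Q lam) (hp : p ≠ ∞) (hA : IsGeneratorOf A T)
    (hM : ∀ t, 0 ≤ t → ‖T t‖ ≤ M) {t : ℝ} (ht : 0 ≤ t) :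
    IsDiagonalOp Q (fun i => Complex.exp (t * lam i)) (T t) :=
  isDiagonalOp_of_apply_basisVec hp fun i => hA.apply_eigenvector hM (hb i) ht

theorem norm_coord_convolution_le (hb : HasEigenbasis A Q lam) (hp : p ≠ ∞)
    (hA : IsGeneratorOf A T) (hM : ∀ t, 0 ≤ t → ‖T t‖ ≤ M) {g : ℝ → X} {t : ℝ} (ht : 0 ≤ t)
    (hg : IntegrableOn g (Ioc 0 t)) {i : ι} (hre : (lam i).re < 0) {c : ℝ}
    (hc₀ : 0 ≤ c)
    (hc : ∀ᵐ s ∂volume.restrict (Ioc 0 t), ‖coord Q i (g s)‖ ≤ c * -(lam i).re) :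
    ‖coord Q i (∫ s in (0 : ℝ)..t, T (t - s) (g s))‖ ≤ c := by
  have : CompleteSpace X := completeSpace_of_equiv_lp Q
  have hω : 0 < -(lam i).re := neg_pos.2 hre
  have hle : ∀ᵐ s, s ∈ Ioc 0 t → ‖coord Q i (T (t - s) (g s))‖ ≤
      Real.exp ((t - s) * (lam i).re) * (c * -(lam i).re) := by
    filter_upwards [(ae_restrict_iff' measurableSet_Ioc).1 hc] with s hs hst
    rw [hb.isDiagonalOp_semigroup hp hA hM (sub_nonneg.2 hst.2), norm_mul, Complex.norm_exp,
      Complex.re_ofReal_mul]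
    gcongr
    exact hs hst
  calc ‖coord Q i (∫ s in (0 : ℝ)..t, T (t - s) (g s))‖
      = ‖∫ s in (0 : ℝ)..t, coord Q i (T (t - s) (g s))‖ := by
        rw [(coord Q i).intervalIntegral_comp_comm
          (hA.isC0Semigroup.intervalIntegrable_convolution hM ht hg)]
    _ ≤ ∫ s in (0 : ℝ)..t, Real.exp ((t - s) * (lam i).re) * (c * -(lam i).re) :=
        intervalIntegral.norm_integral_le_of_norm_le ht hle
          (by apply Continuous.intervalIntegrable; fun_prop)
    _ ≤ (-(lam i).re)⁻¹ * (c * -(lam i).re) := by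
        rw [intervalIntegral.integral_mul_const]
        gcongr
        exact integral_exp_sub_mul_le hre t
    _ = c := by rw [mul_comm c, inv_mul_cancel_left₀ hω.ne']

variable {U : Type*} [NormedAddCommGroup U] [NormedSpace ℂ U]

theorem isInfiniteTimeAdmissible {α : ℝ} (hb : HasEigenbasis A Q lam) (hp : p ≠ ∞)
    (hA : IsGeneratorOf A T) (hstab : IsPolynomiallyStable A T α) {B : U →L[ℂ] X} {S : U → X}
    (hS : IsOrderBounded Q S) (hBS : ∀ u, negPowNeg A α (S u) = B u) :
    IsInfiniteTimeAdmissible T B := by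
  obtain ⟨M, hM⟩ := hstab.semiUniformlyStable.bounded
  obtain ⟨C₁, hC₁, heig⟩ := hstab.exists_eigenvalue_bound hA
  obtain ⟨C₂, hC₂, hsymbol⟩ := exists_norm_negPowSymbol_le hstab.pos
  obtain ⟨z, hz⟩ := hS
  have hlam := fun i => heig (basisVec Q i) (lam i) (basisVec_ne_zero i) (hb i)
  have hdiag := hb.isDiagonalOp_negPowNeg hp hstab.zero_mem (fun i => (hlam i).1.le) hstab.pos
  have hB : ∀ v i, ‖coord Q i (B v)‖ ≤ C₂ * C₁ * ‖v‖ * ‖coord Q i z‖ * -(lam i).re := by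
    intro v i
    have hne : lam i ≠ 0 := fun h => (hlam i).1.ne (by rw [h, Complex.zero_re])
    calc ‖coord Q i (B v)‖ = ‖negPowSymbol α (lam i)‖ * ‖coord Q i (S v)‖ := by
          rw [← hBS, hdiag, norm_mul]
      _ ≤ (C₂ * (C₁ * -(lam i).re)) * (‖v‖ * ‖coord Q i z‖) := by
          gcongr
          · have := neg_pos.2 (hlam i).1
            positivity
          · exact (hsymbol _ (hlam i).1.le hne).trans (by gcongr; exact (hlam i).2)
          · exact hz v i
      _ = C₂ * C₁ * ‖v‖ * ‖coord Q i z‖ * -(lam i).re := by ring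
  refine ⟨condNumber Q * (C₂ * C₁) * ‖z‖,
    mul_nonneg (mul_nonneg condNumber_nonneg (by positivity)) (norm_nonneg z), fun u t ht => ?_⟩
  have hcoord : ∀ i, ‖coord Q i (∫ s in (0 : ℝ)..t, T (t - s) (B (u s)))‖ ≤
      C₂ * C₁ * ‖u‖ * ‖coord Q i z‖ := fun i => by
    refine hb.norm_coord_convolution_le hp hA hM ht ?_ (hlam i).1 (by positivity) ?_
    · exact ((u.locallyIntegrableOn_apply B).integrableOn_compact_subset Icc_subset_Ici_self
        isCompact_Icc).mono_set Ioc_subset_Icc_self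
    · filter_upwards [ae_restrict_of_ae_restrict_of_subset
        (Ioc_subset_Icc_self.trans Icc_subset_Ici_self) u.ae_norm_le] with s hs
      have := neg_pos.2 (hlam i).1
      exact (hB (u s) i).trans (by gcongr)
  calc ‖∫ s in (0 : ℝ)..t, T (t - s) (B (u s))‖
      ≤ condNumber Q * (C₂ * C₁ * ‖u‖) * ‖z‖ := norm_le_of_norm_coord_le (by positivity) hcoord
    _ = condNumber Q * (C₂ * C₁) * ‖z‖ * ‖u‖ := by ring

end HasEigenbasis

end Admissibility

section InputToStateStability

theorem isClassKInf_mul {c : ℝ≥0} (hc : 0 < c) : IsClassKInf fun r => c * r where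
  continuous := by fun_prop
  strictMono := fun _ _ h => mul_lt_mul_of_pos_left h hc
  map_zero := mul_zero c
  unbounded := by
    rintro ⟨b, hb⟩
    have hle : c * ((b + 1) / c) ≤ b := hb ⟨_, rfl⟩
    rw [mul_div_cancel₀ _ hc.ne'] at hle
    exact absurd hle (not_le.2 (lt_add_one b))

theorem isClassKL_mul_inv_rpow {c : ℝ≥0} (hc : 0 < c) {β : ℝ} (hβ : 0 < β) :
    IsClassKL fun r t => c * r * ((1 + t) ^ β)⁻¹ := by
  have hpos : ∀ t : ℝ≥0, 0 < (1 + t) ^ β := fun t => NNReal.rpow_pos (by positivity)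
  have hcont : Continuous fun t : ℝ≥0 => ((1 + t) ^ β)⁻¹ :=
    ((NNReal.continuous_rpow_const hβ.le).comp (continuous_const.add continuous_id)).inv₀
      fun t => (hpos t).ne'
  have hanti : StrictAnti fun t : ℝ≥0 => ((1 + t) ^ β)⁻¹ := fun s t h =>
    (inv_lt_inv₀ (hpos t) (hpos s)).2 (NNReal.rpow_lt_rpow (by gcongr) hβ)
  have hlim : Tendsto (fun t : ℝ≥0 => ((1 + t) ^ β)⁻¹) atTop (𝓝 0) :=
    ((NNReal.tendsto_rpow_atTop hβ).comp
      (tendsto_atTop_mono (fun _ => le_add_self) tendsto_id)).inv_tendsto_atTop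
  refine ⟨(continuous_const.mul continuous_fst).mul (hcont.comp continuous_snd),
    fun t => ⟨by fun_prop, fun r r' h => ?_, by simp⟩,
    fun r hr => ⟨continuous_const.mul hcont, fun s t h => ?_, ?_⟩⟩
  · exact mul_lt_mul_of_pos_right (mul_lt_mul_of_pos_left h hc) (inv_pos.2 (hpos t))
  · exact mul_lt_mul_of_pos_left (hanti h) (mul_pos hc hr)
  · simpa using hlim.const_mul (c * r)

theorem isBigO_mul_inv_one_add_rpow (c : ℝ≥0) {β : ℝ} (hβ : 0 ≤ β) :
    (fun t : ℝ≥0 => ((c * ((1 + t) ^ β)⁻¹ : ℝ≥0) : ℝ)) =O[atTop]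
      fun t : ℝ≥0 => (t : ℝ) ^ (-β) := by
  refine IsBigO.of_bound c ?_
  filter_upwards [eventually_gt_atTop 0] with t ht
  have ht₀ : (0 : ℝ) < t := ht
  push_cast
  rw [Real.norm_of_nonneg (by positivity), Real.norm_of_nonneg (by positivity),
    Real.rpow_neg ht₀.le]
  gcongr
  exact le_add_of_nonneg_left zero_le_one

variable {X : Type*} [NormedAddCommGroup X] [NormedSpace ℂ X] {U : Type*} [NormedAddCommGroup U]
  [NormedSpace ℂ U] {T : ℝ → X →L[ℂ] X} {B : U →L[ℂ] X}

theorem IsInfiniteTimeAdmissible.exists_norm_mildSolution_le (hB : IsInfiniteTimeAdmissible T B) :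
    ∃ C : ℝ≥0, 0 < C ∧ ∀ (x₀ : X) (u : Input U) (x : ℝ → X),
      IsMildSolution T (fun _ v => B v) x₀ u x →
        ∀ t : ℝ≥0, ‖x t‖₊ ≤ ‖T t x₀‖₊ + C * ‖u‖₊ := by
  obtain ⟨C, hC, hconv⟩ := hB
  lift C to ℝ≥0 using hC
  refine ⟨C + 1, by positivity, fun x₀ u x hx t => ?_⟩
  rw [hx.eq t t.2]
  refine (nnnorm_add_le _ _).trans ?_
  gcongr
  calc ‖∫ s in (0 : ℝ)..t, T (t - s) (B (u s))‖₊ ≤ C * ‖u‖₊ := hconv u t t.2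
    _ ≤ (C + 1) * ‖u‖₊ := by
        gcongr
        exact le_self_add

theorem IsPolynomiallyStable.isLinPolyISS {A : X →ₗ.[ℂ] X} {α : ℝ}
    (hstab : IsPolynomiallyStable A T α) (hT : IsC0Semigroup T)
    (hB : IsInfiniteTimeAdmissible T B) : IsLinPolyISS A T B α := by
  obtain ⟨M, hM⟩ := hstab.semiUniformlyStable.bounded
  obtain ⟨K, hK, hdecay⟩ := hstab.exists_norm_apply_le
  obtain ⟨C, hC, hbound⟩ := hB.exists_norm_mildSolution_le
  have hα := one_div_pos.2 hstab.pos
  lift K to ℝ≥0 using hK.le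
  have hgrowth : ∀ (x₀ : X) (t : ℝ≥0), ‖T t x₀‖₊ ≤ (M.toNNReal + 1) * ‖x₀‖₊ := fun x₀ t => by
    refine ((T t).le_opNNNorm x₀).trans ?_
    gcongr
    exact (NNReal.le_toNNReal_of_coe_le (hM t t.2)).trans le_self_add
  have hgraph : ∀ (x₀ : A.domain) (t : ℝ≥0), ‖T t (x₀ : X)‖₊ ≤
      K * (‖(x₀ : X)‖₊ + ‖A x₀‖₊) * ((1 + t) ^ (1 / α))⁻¹ := fun x₀ t => by
    rw [← NNReal.coe_le_coe]
    push_cast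
    calc ‖T t (x₀ : X)‖ ≤ K * ‖A x₀‖ * ((1 + (t : ℝ)) ^ (1 / α))⁻¹ := by
          rw [← Real.rpow_neg (by positivity), mul_right_comm]
          exact hdecay x₀ t t.2
      _ ≤ K * (‖(x₀ : X)‖ + ‖A x₀‖) * ((1 + (t : ℝ)) ^ (1 / α))⁻¹ := by
          gcongr
          exact le_add_of_nonneg_left (norm_nonneg _)
  exact
    { pos := hstab.pos
      ugs :=
        { forwardComplete := isForwardComplete_linear hT hM B
          bound := ⟨_, _, isClassKInf_mul (by positivity), isClassKInf_mul hC, fun x₀ u x hx t =>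
            (hbound x₀ u x hx t).trans (add_le_add_left (hgrowth x₀ t) _)⟩ }
      bound := ⟨_, _, isClassKL_mul_inv_rpow hK hα, isClassKInf_mul hC, fun x₀ u x hx t =>
        (hbound x₀ u x hx t).trans (add_le_add_left (hgraph x₀ t) _),
        fun r _ => isBigO_mul_inv_one_add_rpow (K * r) hα.le⟩ }

end InputToStateStability

end PolyISS

theorem mainTheorem5_general {ι : Type*} [DecidableEq ι] {p : ℝ≥0∞} [Fact (1 ≤ p)] (hp : p ≠ ∞)
    {X : Type*} [NormedAddCommGroup X] [NormedSpace ℂ X]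
    {U : Type*} [NormedAddCommGroup U] [NormedSpace ℂ U]
    (A : X →ₗ.[ℂ] X) (Q : X ≃L[ℂ] lp (fun _ : ι => ℂ) p) (lam : ι → ℂ)
    (hA : PolyISS.HasEigenbasis A Q lam)
    (T : ℝ → X →L[ℂ] X) (hT : PolyISS.IsGeneratorOf A T)
    (α : ℝ) (hstab : PolyISS.IsPolynomiallyStable A T α)
    (B : U →L[ℂ] X) (S : U → X) (hS : PolyISS.IsOrderBounded Q S)
    (hBS : ∀ u, PolyISS.negPowNeg A α (S u) = B u) :
    PolyISS.IsLinPolyISS A T B α :=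
  hstab.isLinPolyISS hT.isC0Semigroup (hA.isInfiniteTimeAdmissible hp hT hstab hS hBS)

theorem mainTheorem5 {X : Type*} [NormedAddCommGroup X] [InnerProductSpace ℂ X] [CompleteSpace X]
    {U : Type*} [NormedAddCommGroup U] [NormedSpace ℂ U] [CompleteSpace U]
    (A : X →ₗ.[ℂ] X) (hA : PolyISS.IsDiagonalizable A)
    (T : ℝ → X →L[ℂ] X) (hT : PolyISS.IsGeneratorOf A T)
    (α : ℝ) (hα : 0 < α) (hstab : PolyISS.IsPolynomiallyStable A T α)
    (B : U →L[ℂ] X) (hfin : FiniteDimensional ℂ (LinearMap.range (B : U →ₗ[ℂ] X)))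
    (hran : LinearMap.range (B : U →ₗ[ℂ] X) ≤ (PolyISS.negPow A α).domain) :
    PolyISS.IsLinPolyISS A T B α := by
  obtain ⟨Q, lam, hQ⟩ := hA.exists_hasEigenbasis
  obtain ⟨S, _, hBS⟩ := PolyISS.exists_finiteRank_factorization B
    (PolyISS.negPowNeg A α : X →ₗ[ℂ] X) (hran.trans_eq PolyISS.negPow_domain)
  exact mainTheorem5_general (by norm_num) A Q lam hQ T hT α hstab B S
    (PolyISS.isOrderBounded_of_finiteDimensional_range S) hBS
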